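/- Work in the universe $V$ of all sets (with the axiom of choice). Let $M$ be a transitive class and let $j : V \to M$ be an elementary embedding for the first-order language of set theory $\{\in\}$, with critical point $\kappa$ (the least ordinal with $j(\kappa)\neq\kappa$). For a cardinal $\mu$ (identified with its initial ordinal) let the tightness $t_j(\mu)$ be the least $M$-cardinality $|A|^M$ of a set $A \in M$ with $j[\mu] = \{ j(\alpha) : \alpha < \mu \} \subseteq A$. **Lemma.** Let $\lambda$ be a singular cardinal of cofinality $\iota < \kappa$. Then there is an $M$-cardinal $\eta$ with $\mathrm{cf}^M(\eta) = \iota$ such that $$\eta < t_j(\lambda^{\iota}) \le (\eta^{\iota})^M .$$ Here $\lambda^\iota$ is cardinal exponentiation in $V$, and $M$-cardinals, $|\cdot|^M$, $\mathrm{cf}^M$ and $(\eta^\iota)^M$ (the $M$-cardinality of the set of all functions $\iota\to\eta$ lying in $M$) are the cardinals, cardinality, cofinality and cardinal exponentiation as computed in $M$. -/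

import Mathlib

universe u

namespace SetEmb

/-- The relation symbols of the language of set theory: one binary symbol for membership. -/
inductive MemRel : ℕ → Type
  | mem : MemRel 2

/-- The first-order language of set theory (membership, together with equality). -/
def setLang : FirstOrder.Language.{0, 0} := ⟨fun _ => Empty, MemRel⟩

instance setLangIsRelational : setLang.IsRelational :=
  fun _ => inferInstanceAs (IsEmpty Empty)

/-- The universe of sets as a structure for the language of set theory. -/
instance univStructure : setLang.Structure ZFSet.{u} where
  RelMap | .mem => fun v => v 0 ∈ v 1

/-- A class `M` of sets, with the true membership relation, as a structure for the language of
set theory. -/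
instance classStructure (M : Set ZFSet.{u}) : setLang.Structure M where
  RelMap | .mem => fun v => (v 0 : ZFSet.{u}) ∈ (v 1 : ZFSet.{u})

/-- `M` is a transitive class: elements of elements of `M` are in `M`. -/
def IsTransitiveClass (M : Set ZFSet.{u}) : Prop :=
  ∀ x ∈ M, ∀ y ∈ x, y ∈ M

/-- The set `f` is (the graph of) a bijection from the set `x` onto the set `y`. -/
def IsBijection (x y f : ZFSet.{u}) : Prop :=
  ZFSet.IsFunc x y f ∧ ∀ w ∈ y, ∃! z, ZFSet.pair z w ∈ f

/-- The set `f` is a function from `x` to the von Neumann ordinal `y` whose range is unbounded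
in `y`. -/
def IsCofinalFunc (x y f : ZFSet.{u}) : Prop :=
  ZFSet.IsFunc x y f ∧ ∀ b ∈ y, ∃ z w, ZFSet.pair z w ∈ f ∧ (b = w ∨ b ∈ w)

/-- `x` and `y` are equinumerous in `M`: some bijection between them is an element of `M`. -/
def EquinumIn (M : Set ZFSet.{u}) (x y : ZFSet.{u}) : Prop :=
  ∃ f ∈ M, IsBijection x y f

/-- The ordinal `η` is an `M`-cardinal: it belongs to `M`, and `M` has no bijection between `η`
and a smaller ordinal. -/
def IsCardIn (M : Set ZFSet.{u}) (η : Ordinal.{u}) : Prop :=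
  η.toZFSet ∈ M ∧ ∀ α < η, ¬ EquinumIn M α.toZFSet η.toZFSet

/-- The `M`-cardinality `|x|^M` of `x`: the least ordinal equinumerous with `x` in `M`. -/
noncomputable def cardIn (M : Set ZFSet.{u}) (x : ZFSet.{u}) : Ordinal.{u} :=
  sInf {α | EquinumIn M α.toZFSet x}

/-- The `M`-cofinality `cf^M(η)`: the least ordinal that some function in `M` maps cofinally
into `η`. -/
noncomputable def cofIn (M : Set ZFSet.{u}) (η : Ordinal.{u}) : Ordinal.{u} :=
  sInf {α | ∃ f ∈ M, IsCofinalFunc α.toZFSet η.toZFSet f}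

/-- Cardinal exponentiation in `M`, `(η ^ ι)^M`: the `M`-cardinality of the set of all functions
from `ι` to `η` that belong to `M`. -/
noncomputable def powIn (M : Set ZFSet.{u}) (η ι : Ordinal.{u}) : Ordinal.{u} :=
  cardIn M (ZFSet.sep (fun f => f ∈ M) (ZFSet.funs ι.toZFSet η.toZFSet))

/-- `κ` is the critical point of `j`: the least ordinal that `j` moves. -/
def IsCriticalPoint {M : Set ZFSet.{u}} (j : setLang.ElementaryEmbedding ZFSet.{u} M) (κ : Ordinal.{u}) : Prop :=
  (j κ.toZFSet : ZFSet.{u}) ≠ κ.toZFSet ∧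
    ∀ α < κ, (j α.toZFSet : ZFSet.{u}) = α.toZFSet

/-- `A` covers the pointwise image `j[X]`. -/
def CoversImage {M : Set ZFSet.{u}} (j : setLang.ElementaryEmbedding ZFSet.{u} M) (X A : ZFSet.{u}) : Prop :=
  ∀ x ∈ X, (j x : ZFSet.{u}) ∈ A

/-- The tightness function `t_j(lam)`: the least `M`-cardinality of a set in `M` that covers
`j[lam]`, where the cardinal `lam` is identified with its initial ordinal. -/
noncomputable def tightness {M : Set ZFSet.{u}} (j : setLang.ElementaryEmbedding ZFSet.{u} M)
    (lam : Cardinal.{u}) : Ordinal.{u} :=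
  sInf {θ | ∃ A ∈ M, CoversImage j lam.ord.toZFSet A ∧ cardIn M A = θ}

end SetEmb

/-! The witness is `η = t_j(λ)`. Given a cover `A ∈ M` of `j[μ]` with `|A|^M = t_j(μ)`, a bijection
in `M` from `t_j(μ)` to `A` gives each `α < μ` an index below `t_j(μ)`, the preimage of `j(α)`. The
key fact (`tightness_le`, `mk_index_lt`) is that for `ζ < t_j(λ)` in `M` fewer than `λ` indices lie
below `ζ`: otherwise, composing with `j(e)` for a suitable partial map `e` onto `λ`, `M` would cover
`j[λ]` by a set of size at most `ζ`.

Three consequences follow. An injectively indexed family whose proper initial segments all have size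
below `λ` has size at most `λ`, so `t_j` is strictly increasing on infinite cardinals
(`tightness_lt_of_lt`); König's `λ < λ^ι` then gives `η < t_j(λ^ι)`. A sequence of length `ι =
cf(λ)` with unbounded indices is carried into `M` by `j`, which fixes `ι` and its elements, and no
shorter sequence can be cofinal (`cofIn_tightness`). Finally, for `s : ι → λ` the function `j(s)`
takes values in `A`, so it is coded in `M` by a function `ι → η`; decoding covers the images of all
`λ^ι` functions (`tightness_power_le`).

What `M` must know (pairing, composition, replacement, choice) is obtained by transferring single
sentences along `j`. -/

namespace SetEmb

/-! ### Formulas with named variables and their transfer along `j`. -/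

/-- First-order formulas of set theory, with variables named by natural numbers. -/
inductive Fml : Type
  | mem (i j : ℕ)
  | eq (i j : ℕ)
  | bot
  | imp (φ ψ : Fml)
  | all (n : ℕ) (φ : Fml)

namespace Fml

/-- Satisfaction in a domain `N` whose elements are interpreted as sets by `c`. -/
def Sat {N : Type*} (c : N → ZFSet.{u}) : Fml → (ℕ → N) → Prop
  | mem i j, v => c (v i) ∈ c (v j)
  | eq i j, v => c (v i) = c (v j)
  | bot, _ => False
  | imp φ ψ, v => φ.Sat c v → ψ.Sat c v
  | all n φ, v => ∀ x, φ.Sat c (Function.update v n x)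

def not (φ : Fml) : Fml := φ.imp bot
def or (φ ψ : Fml) : Fml := φ.not.imp ψ
def and (φ ψ : Fml) : Fml := (φ.imp ψ.not).not
def iff (φ ψ : Fml) : Fml := (φ.imp ψ).and (ψ.imp φ)
def ex (n : ℕ) (φ : Fml) : Fml := (all n φ.not).not

section Sat
variable {N : Type*} (c : N → ZFSet.{u}) (v : ℕ → N) (φ ψ : Fml) (n i j : ℕ)

@[simp] theorem sat_mem : (mem i j).Sat c v ↔ c (v i) ∈ c (v j) := Iff.rfl
@[simp] theorem sat_eq : (eq i j).Sat c v ↔ c (v i) = c (v j) := Iff.rfl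
@[simp] theorem sat_bot : bot.Sat c v ↔ False := Iff.rfl
@[simp] theorem sat_imp : (φ.imp ψ).Sat c v ↔ (φ.Sat c v → ψ.Sat c v) := Iff.rfl
@[simp] theorem sat_all : (all n φ).Sat c v ↔ ∀ x, φ.Sat c (Function.update v n x) := Iff.rfl
@[simp] theorem sat_not : φ.not.Sat c v ↔ ¬ φ.Sat c v := Iff.rfl
@[simp] theorem sat_or : (φ.or ψ).Sat c v ↔ φ.Sat c v ∨ ψ.Sat c v := by
  simp only [or, sat_imp, sat_not]; tauto
@[simp] theorem sat_and : (φ.and ψ).Sat c v ↔ φ.Sat c v ∧ ψ.Sat c v := by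
  simp only [and, sat_imp, sat_not]; tauto
@[simp] theorem sat_iff : (φ.iff ψ).Sat c v ↔ (φ.Sat c v ↔ ψ.Sat c v) := by
  simp only [iff, sat_imp, sat_and]; tauto
@[simp] theorem sat_ex : (ex n φ).Sat c v ↔ ∃ x, φ.Sat c (Function.update v n x) := by
  simp only [ex, sat_all, sat_not, not_forall, not_not]

end Sat

/-- The membership symbol. -/
def memSym : setLang.Relations 2 := MemRel.mem

open FirstOrder Language in
/-- The translation into first-order formulas in the sense of Mathlib. -/
def toFormula : Fml → setLang.Formula ℕ
  | mem i j => Relations.formula₂ memSym (Term.var i) (Term.var j)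
  | eq i j => Term.equal (Term.var i) (Term.var j)
  | bot => ⊥
  | imp φ ψ => φ.toFormula.imp ψ.toFormula
  -- The named variable `n` becomes the one bound index; all other names stay free.
  | all n φ => (BoundedFormula.relabel (n := 1)
      (fun i : ℕ => if i = n then (Sum.inr 0 : ℕ ⊕ Fin 1) else Sum.inl i) φ.toFormula).all

open FirstOrder Language in
theorem realize_toFormula {N : Type*} [setLang.Structure N] (c : N → ZFSet.{u})
    (hc : Function.Injective c)
    (hm : ∀ x y : N, Structure.RelMap memSym ![x, y] ↔ c x ∈ c y)
    (φ : Fml) (v : ℕ → N) : φ.toFormula.Realize v ↔ φ.Sat c v := by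
  induction φ generalizing v with
  | mem i j =>
    rw [toFormula, Formula.realize_rel₂, hm]; rfl
  | eq i j =>
    rw [toFormula, Formula.realize_equal]; exact hc.eq_iff.symm
  | bot => exact Iff.rfl
  | imp φ ψ h1 h2 =>
    rw [toFormula, Formula.realize_imp, h1, h2]; rfl
  | all n φ ih =>
    rw [toFormula, Formula.Realize, BoundedFormula.realize_all, sat_all]
    refine forall_congr' fun x => ?_
    rw [BoundedFormula.realize_relabel, ← ih, Formula.Realize]
    convert Iff.rfl using 2
    funext i
    by_cases h : i = n
    · subst h; simp [Fin.snoc]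
    · simp [h]

/-- An elementary embedding preserves satisfaction. -/
theorem sat_transfer {M : Set ZFSet.{u}} (j : setLang.ElementaryEmbedding ZFSet.{u} M)
    (φ : Fml) (v : ℕ → ZFSet.{u}) :
    φ.Sat id v ↔ φ.Sat (Subtype.val : M → ZFSet.{u}) (j ∘ v) := by
  rw [← realize_toFormula id Function.injective_id (fun _ _ => Iff.rfl),
    ← realize_toFormula (Subtype.val : M → ZFSet.{u}) Subtype.val_injective (fun _ _ => Iff.rfl)]
  exact (j.map_formula _ _).symm

end Fml

/-! ### Absoluteness of basic notions for transitive classes. -/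

/-- `c` interprets `N` as a transitive class. -/
def TransRange {N : Type*} (c : N → ZFSet.{u}) : Prop :=
  ∀ x, ∀ y ∈ c x, ∃ z, c z = y

theorem transRange_id : TransRange (id : ZFSet.{u} → ZFSet.{u}) := fun _ y _ => ⟨y, rfl⟩

theorem transRange_val {M : Set ZFSet.{u}} (hM : IsTransitiveClass M) :
    TransRange (Subtype.val : M → ZFSet.{u}) := fun x y hy => ⟨⟨y, hM x x.2 y hy⟩, rfl⟩

/-- Transitivity makes a bounded quantifier over `N` range over all actual elements; this is the
source of absoluteness. -/
theorem TransRange.ex_iff {N : Type*} {c : N → ZFSet.{u}} (hc : TransRange c) (x : N)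
    (P : ZFSet.{u} → Prop) : (∃ y, c y ∈ c x ∧ P (c y)) ↔ ∃ y ∈ c x, P y := by
  constructor
  · rintro ⟨y, h⟩; exact ⟨_, h⟩
  · rintro ⟨y, h, hp⟩; obtain ⟨z, rfl⟩ := hc x y h; exact ⟨z, h, hp⟩

theorem TransRange.all_iff {N : Type*} {c : N → ZFSet.{u}} (hc : TransRange c) (x : N)
    (P : ZFSet.{u} → Prop) : (∀ y, c y ∈ c x → P (c y)) ↔ ∀ y ∈ c x, P y := by
  constructor
  · intro h y hy; obtain ⟨z, rfl⟩ := hc x y hy; exact h z hy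
  · intro h y hy; exact h _ hy

namespace Fml

/-- `w = {x, y}` -/
def upairF (w x y : ℕ) : Fml :=
  ((mem x w).and (mem y w)).and
    -- The index `w + x + y + 1` exceeds every free one, so the bound variable is fresh.
    (all (w + x + y + 1) ((mem (w + x + y + 1) w).imp
      ((eq (w + x + y + 1) x).or (eq (w + x + y + 1) y))))

/-- `z = (x, y)` -/
def pairF (z x y : ℕ) : Fml :=
  ((ex (z + x + y + 1) ((mem (z + x + y + 1) z).and (upairF (z + x + y + 1) x x))).and
    (ex (z + x + y + 1) ((mem (z + x + y + 1) z).and (upairF (z + x + y + 1) x y)))).and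
    (all (z + x + y + 1) ((mem (z + x + y + 1) z).imp
      ((upairF (z + x + y + 1) x x).or (upairF (z + x + y + 1) x y))))

/-- `(x, y) ∈ f` -/
def pmemF (x y f : ℕ) : Fml :=
  ex (x + y + f + 1) ((mem (x + y + f + 1) f).and (pairF (x + y + f + 1) x y))

section Abs
variable {N : Type*} {c : N → ZFSet.{u}}

theorem sat_upairF (hc : TransRange c) (v : ℕ → N) (w x y : ℕ) :
    (upairF w x y).Sat c v ↔ c (v w) = {c (v x), c (v y)} := by
  have h1 : w ≠ w + x + y + 1 := by omega
  have h2 : x ≠ w + x + y + 1 := by omega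
  have h3 : y ≠ w + x + y + 1 := by omega
  simp only [upairF, sat_and, sat_mem, sat_all, sat_imp, sat_or, sat_eq, Function.update_self,
    Function.update_of_ne h1, Function.update_of_ne h2, Function.update_of_ne h3]
  rw [hc.all_iff (v w) (fun u => u = c (v x) ∨ u = c (v y))]
  constructor
  · rintro ⟨⟨hx, hy⟩, h⟩
    ext u
    rw [ZFSet.mem_pair]
    exact ⟨h u, by rintro (rfl | rfl) <;> assumption⟩
  · intro h
    simp [h]

theorem sat_pairF (hc : TransRange c) (v : ℕ → N) (z x y : ℕ) :
    (pairF z x y).Sat c v ↔ c (v z) = ZFSet.pair (c (v x)) (c (v y)) := by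
  have h1 : z ≠ z + x + y + 1 := by omega
  have h2 : x ≠ z + x + y + 1 := by omega
  have h3 : y ≠ z + x + y + 1 := by omega
  simp only [pairF, sat_and, sat_mem, sat_all, sat_imp, sat_or, sat_ex, sat_upairF hc,
    Function.update_self,
    Function.update_of_ne h1, Function.update_of_ne h2, Function.update_of_ne h3]
  rw [hc.all_iff (v z) (fun u => u = {c (v x), c (v x)} ∨ u = {c (v x), c (v y)}),
    hc.ex_iff (v z) (fun u => u = {c (v x), c (v x)}),
    hc.ex_iff (v z) (fun u => u = {c (v x), c (v y)})]
  simp only [exists_eq_right, ZFSet.pair, ZFSet.pair_eq_singleton]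
  constructor
  · rintro ⟨⟨hx, hy⟩, h⟩
    ext u
    rw [ZFSet.mem_pair]
    exact ⟨h u, by rintro (rfl | rfl) <;> assumption⟩
  · intro h
    simp [h]

theorem sat_pmemF (hc : TransRange c) (v : ℕ → N) (x y f : ℕ) :
    (pmemF x y f).Sat c v ↔ ZFSet.pair (c (v x)) (c (v y)) ∈ c (v f) := by
  have h1 : f ≠ x + y + f + 1 := by omega
  have h2 : x ≠ x + y + f + 1 := by omega
  have h3 : y ≠ x + y + f + 1 := by omega
  simp only [pmemF, sat_and, sat_mem, sat_ex, sat_pairF hc,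
    Function.update_self,
    Function.update_of_ne h1, Function.update_of_ne h2, Function.update_of_ne h3]
  rw [hc.ex_iff (v f) (fun u => u = ZFSet.pair (c (v x)) (c (v y)))]
  simp

end Abs
end Fml
end SetEmb
namespace SetEmb

/-- Coordinates sit inside a Kuratowski pair, so unbounded quantifiers over coordinates of elements
of `f` are absolute too. -/
theorem TransRange.of_pair_mem {N : Type*} {c : N → ZFSet.{u}} (hc : TransRange c) {f : N}
    {a b : ZFSet.{u}} (h : ZFSet.pair a b ∈ c f) : (∃ x, c x = a) ∧ ∃ y, c y = b := by
  obtain ⟨p, hp⟩ := hc f _ h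
  have hq : ({a, b} : ZFSet.{u}) ∈ c p := by rw [hp]; simp [ZFSet.pair]
  obtain ⟨q, hq'⟩ := hc p _ hq
  exact ⟨hc q _ (by rw [hq']; simp), hc q _ (by rw [hq']; simp)⟩

/-- `f` is single-valued. -/
def SingleValued (f : ZFSet.{u}) : Prop :=
  ∀ x y z, ZFSet.pair x y ∈ f → ZFSet.pair x z ∈ f → y = z

namespace Fml

/-- `f` is a function from `x` to `y`; the bound variables start at `k`. -/
def funcF (k x y f : ℕ) : Fml :=
  (all k ((mem k f).imp (ex (k + 1) ((mem (k + 1) x).and (ex (k + 2) ((mem (k + 2) y).and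
    (pairF k (k + 1) (k + 2)))))))).and
  (all k ((mem k x).imp (ex (k + 1) ((pmemF k (k + 1) f).and
    (all (k + 2) ((pmemF k (k + 2) f).imp (eq (k + 2) (k + 1))))))))

/-- `f` is a bijection from `x` to `y`; the bound variables start at `k`. -/
def bijF (k x y f : ℕ) : Fml :=
  (funcF k x y f).and
  (all k ((mem k y).imp (ex (k + 1) ((pmemF (k + 1) k f).and
    (all (k + 2) ((pmemF (k + 2) k f).imp (eq (k + 2) (k + 1))))))))

/-- `x` is an ordinal; the bound variables start at `k`. -/
def ordF (k x : ℕ) : Fml :=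
  (all k ((mem k x).imp (all (k + 1) ((mem (k + 1) k).imp (mem (k + 1) x))))).and
  (all k ((mem k x).imp (all (k + 1) ((mem (k + 1) k).imp (all (k + 2) ((mem (k + 2) (k + 1)).imp
    (mem (k + 2) k)))))))

/-- `f` is single-valued; the bound variables start at `k`. -/
def singleF (k f : ℕ) : Fml :=
  all k (all (k + 1) (all (k + 2) ((pmemF k (k + 1) f).imp ((pmemF k (k + 2) f).imp
    (eq (k + 1) (k + 2))))))

section Abs
variable {N : Type*} {c : N → ZFSet.{u}}

theorem existsUnique_right_iff (hc : TransRange c) (f : N) (z : ZFSet.{u}) :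
    (∃ w, ZFSet.pair z (c w) ∈ c f ∧ ∀ w', ZFSet.pair z (c w') ∈ c f → c w' = c w) ↔
      ∃! w, ZFSet.pair z w ∈ c f := by
  constructor
  · rintro ⟨w, h1, h2⟩
    refine ⟨c w, h1, fun w' hw' => ?_⟩
    obtain ⟨w', rfl⟩ := (hc.of_pair_mem hw').2
    exact h2 _ hw'
  · rintro ⟨w, h1, h2⟩
    obtain ⟨w, rfl⟩ := (hc.of_pair_mem h1).2
    exact ⟨w, h1, fun w' => h2 _⟩

theorem existsUnique_left_iff (hc : TransRange c) (f : N) (z : ZFSet.{u}) :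
    (∃ w, ZFSet.pair (c w) z ∈ c f ∧ ∀ w', ZFSet.pair (c w') z ∈ c f → c w' = c w) ↔
      ∃! w, ZFSet.pair w z ∈ c f := by
  constructor
  · rintro ⟨w, h1, h2⟩
    refine ⟨c w, h1, fun w' hw' => ?_⟩
    obtain ⟨w', rfl⟩ := (hc.of_pair_mem hw').1
    exact h2 _ hw'
  · rintro ⟨w, h1, h2⟩
    obtain ⟨w, rfl⟩ := (hc.of_pair_mem h1).1
    exact ⟨w, h1, fun w' => h2 _⟩

theorem sat_funcF (hc : TransRange c) (v : ℕ → N) {k x y f : ℕ} (hx : x < k) (hy : y < k)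
    (hf : f < k) : (funcF k x y f).Sat c v ↔ ZFSet.IsFunc (c (v x)) (c (v y)) (c (v f)) := by
  have hx1 : x ≠ k + 1 := by omega
  have hy1 : y ≠ k + 1 := by omega
  have hf1 : f ≠ k + 1 := by omega
  have hy2 : y ≠ k + 2 := by omega
  have hf2 : f ≠ k + 2 := by omega
  simp only [funcF, sat_and, sat_all, sat_imp, sat_mem, sat_ex, sat_pairF hc, sat_pmemF hc, sat_eq,
    Function.update_apply, hx.ne, hy.ne, hf.ne, hx1, hy1, hf1, hy2, hf2, if_true, if_false,
    Nat.left_eq_add, Nat.add_left_cancel_iff, Nat.add_eq_left, one_ne_zero,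
    OfNat.ofNat_ne_one, OfNat.one_ne_ofNat, OfNat.ofNat_ne_zero]
  have e1 : ∀ a : N, (∃ b, c b ∈ c (v x) ∧ ∃ d, c d ∈ c (v y) ∧ c a = ZFSet.pair (c b) (c d)) ↔
      c a ∈ ZFSet.prod (c (v x)) (c (v y)) := fun a => by
    rw [ZFSet.mem_prod, hc.ex_iff (v x)
      (fun b => ∃ d, c d ∈ c (v y) ∧ c a = ZFSet.pair b (c d))]
    refine exists_congr fun b => and_congr_right fun _ => ?_
    rw [hc.ex_iff (v y) (fun d => c a = ZFSet.pair b d)]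
  simp only [e1, existsUnique_right_iff hc]
  rw [hc.all_iff (v f) (fun u => u ∈ ZFSet.prod (c (v x)) (c (v y))),
    hc.all_iff (v x) (fun u => ∃! w, ZFSet.pair u w ∈ c (v f))]
  rfl

theorem sat_bijF (hc : TransRange c) (v : ℕ → N) {k x y f : ℕ} (hx : x < k) (hy : y < k)
    (hf : f < k) : (bijF k x y f).Sat c v ↔ IsBijection (c (v x)) (c (v y)) (c (v f)) := by
  have hf1 : f ≠ k + 1 := by omega
  have hf2 : f ≠ k + 2 := by omega
  simp only [bijF, sat_funcF hc _ hx hy hf, sat_and, sat_all, sat_imp, sat_mem, sat_ex,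
    sat_pmemF hc, sat_eq,
    Function.update_apply, hy.ne, hf.ne, hf1, hf2, if_true, if_false,
    Nat.left_eq_add, Nat.add_left_cancel_iff, Nat.add_eq_left, one_ne_zero,
    OfNat.ofNat_ne_one, OfNat.one_ne_ofNat, OfNat.ofNat_ne_zero]
  simp only [existsUnique_left_iff hc]
  rw [hc.all_iff (v y) (fun u => ∃! w, ZFSet.pair w u ∈ c (v f))]
  rfl

/-- By foundation no well-ordering clause is needed: the formula has bounded quantifiers only. -/
theorem sat_ordF (hc : TransRange c) (v : ℕ → N) {k x : ℕ} (hx : x < k) :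
    (ordF k x).Sat c v ↔ (c (v x)).IsOrdinal := by
  have hx1 : x ≠ k + 1 := by omega
  simp only [ordF, sat_and, sat_all, sat_imp, sat_mem,
    Function.update_apply, hx.ne, hx1, if_true, if_false,
    Nat.left_eq_add, Nat.add_left_cancel_iff, Nat.add_eq_left, one_ne_zero,
    OfNat.ofNat_ne_one, OfNat.one_ne_ofNat, OfNat.ofNat_ne_zero]
  constructor
  · rintro ⟨h1, h2⟩
    refine ⟨fun y hy z hz => ?_, fun {a b d} hab hbd hd => ?_⟩
    · obtain ⟨y, rfl⟩ := hc _ _ hy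
      obtain ⟨z, rfl⟩ := hc _ _ hz
      exact h1 _ hy _ hz
    · obtain ⟨d, rfl⟩ := hc _ _ hd
      obtain ⟨b, rfl⟩ := hc _ _ hbd
      obtain ⟨a, rfl⟩ := hc _ _ hab
      exact h2 _ hd _ hbd _ hab
  · intro h
    exact ⟨fun a ha b hb => h.1 _ ha hb, fun a ha b hb d hd => h.2 hd hb ha⟩

theorem sat_singleF (hc : TransRange c) (v : ℕ → N) {k f : ℕ} (hf : f < k) :
    (singleF k f).Sat c v ↔ SingleValued (c (v f)) := by
  have hf1 : f ≠ k + 1 := by omega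
  have hf2 : f ≠ k + 2 := by omega
  simp only [singleF, sat_all, sat_imp, sat_pmemF hc, sat_eq,
    Function.update_apply, hf.ne, hf1, hf2, if_true, if_false,
    Nat.left_eq_add, Nat.add_left_cancel_iff, Nat.add_eq_left, one_ne_zero,
    OfNat.ofNat_ne_one, OfNat.one_ne_ofNat, OfNat.ofNat_ne_zero]
  constructor
  · intro h x y z hy hz
    obtain ⟨⟨x, rfl⟩, ⟨y, rfl⟩⟩ := hc.of_pair_mem hy
    obtain ⟨z, rfl⟩ := (hc.of_pair_mem hz).2
    exact h _ _ _ hy hz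
  · intro h x y z
    exact h _ _ _

end Abs
end Fml
end SetEmb
-- Facts about sets in `V` that will be transferred.
namespace SetEmb
open ZFSet

theorem exists_zfset_of_subset {D : ZFSet.{u}} (P : ZFSet.{u} → Prop) (h : ∀ u, P u → u ∈ D) :
    ∃ S : ZFSet.{u}, ∀ u, u ∈ S ↔ P u :=
  ⟨ZFSet.sep P D, fun u => by rw [mem_sep]; exact ⟨And.right, fun hu => ⟨h u hu, hu⟩⟩⟩

/-- The field of a relation. -/
noncomputable def field (f : ZFSet.{u}) : ZFSet.{u} := ⋃₀ ⋃₀ f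

theorem mem_field_left {f x y : ZFSet.{u}} (h : pair x y ∈ f) : x ∈ field f := by
  simp only [field, mem_sUnion]
  exact ⟨{x}, ⟨_, h, by simp [pair]⟩, by simp⟩

theorem mem_field_right {f x y : ZFSet.{u}} (h : pair x y ∈ f) : y ∈ field f := by
  simp only [field, mem_sUnion]
  exact ⟨{x, y}, ⟨_, h, by simp [pair]⟩, by simp⟩

theorem exists_comp (f g : ZFSet.{u}) : ∃ h : ZFSet.{u}, ∀ u, u ∈ h ↔
    ∃ x y z, u = pair x z ∧ pair x y ∈ f ∧ pair y z ∈ g := by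
  refine exists_zfset_of_subset (D := prod (field f) (field g)) _ ?_
  rintro _ ⟨x, y, z, rfl, h1, h2⟩
  exact pair_mem_prod.2 ⟨mem_field_left h1, mem_field_right h2⟩

theorem exists_compInv (f g : ZFSet.{u}) : ∃ h : ZFSet.{u}, ∀ u, u ∈ h ↔
    ∃ x y z, u = pair x z ∧ pair x y ∈ f ∧ pair z y ∈ g := by
  refine exists_zfset_of_subset (D := prod (field f) (field g)) _ ?_
  rintro _ ⟨x, y, z, rfl, h1, h2⟩
  exact pair_mem_prod.2 ⟨mem_field_left h1, mem_field_left h2⟩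

/-- The graph of the assignment `p i ↦ q i`. -/
noncomputable def graph {I : Type*} [Small.{u} I] (p q : I → ZFSet.{u}) : ZFSet.{u} :=
  ZFSet.range fun i => pair (p i) (q i)

theorem mem_graph {I : Type*} [Small.{u} I] {p q : I → ZFSet.{u}} {z : ZFSet.{u}} :
    z ∈ graph p q ↔ ∃ i, z = pair (p i) (q i) := by
  simp [graph, eq_comm]

theorem pair_mem_graph {I : Type*} [Small.{u} I] {p q : I → ZFSet.{u}} {a b : ZFSet.{u}} :
    pair a b ∈ graph p q ↔ ∃ i, a = p i ∧ b = q i := by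
  simp [mem_graph]

theorem singleValued_graph {I : Type*} [Small.{u} I] {p q : I → ZFSet.{u}}
    (hp : Function.Injective p) : SingleValued (graph p q) := by
  intro x y z hy hz
  obtain ⟨i, rfl, rfl⟩ := pair_mem_graph.1 hy
  obtain ⟨k, hk, rfl⟩ := pair_mem_graph.1 hz
  rw [hp hk]

theorem isFunc_graph {x y : ZFSet.{u}} (q : x → ZFSet.{u}) (hq : ∀ i, q i ∈ y) :
    IsFunc x y (graph (fun i : x => (i : ZFSet.{u})) q) := by
  refine ⟨fun z hz => ?_, fun z hz => ⟨q ⟨z, hz⟩, pair_mem_graph.2 ⟨⟨z, hz⟩, rfl, rfl⟩, ?_⟩⟩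
  · obtain ⟨i, rfl⟩ := mem_graph.1 hz
    exact pair_mem_prod.2 ⟨i.2, hq i⟩
  · intro w hw
    obtain ⟨i, h, rfl⟩ := pair_mem_graph.1 hw
    simp only [h]

theorem exists_isBijection {x y : ZFSet.{u}} (h : x.card = y.card) : ∃ f, IsBijection x y f := by
  have h' : Cardinal.mk x = Cardinal.mk y := by
    rw [cardinalMk_coe_sort, cardinalMk_coe_sort, h]
  obtain ⟨e⟩ := Cardinal.eq.1 h'
  refine ⟨graph (fun i : x => (i : ZFSet.{u})) (fun i => (e i : ZFSet.{u})),
    isFunc_graph _ fun i => (e i).2, fun w hw => ⟨e.symm ⟨w, hw⟩, ?_, ?_⟩⟩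
  · exact pair_mem_graph.2 ⟨e.symm ⟨w, hw⟩, rfl, by simp⟩
  · intro z hz
    obtain ⟨i, rfl, rfl⟩ := pair_mem_graph.1 hz
    simp

theorem exists_ordinal_bijection (x : ZFSet.{u}) :
    ∃ f, IsBijection x.card.ord.toZFSet x f :=
  exists_isBijection (by simp)

/-- Choosing preimages injects `B` into `a`. Replacement and choice are packed into one statement so
that it transfers as a single sentence. -/
theorem exists_image {f a : ZFSet.{u}} (ha : a.IsOrdinal) (hf : SingleValued f) :
    ∃ B : ZFSet.{u}, (∀ y, y ∈ B ↔ ∃ x, x ∈ a ∧ pair x y ∈ f) ∧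
      ∃ b g : ZFSet.{u}, b.IsOrdinal ∧ (b = a ∨ b ∈ a) ∧ IsBijection b B g := by
  obtain ⟨B, hB⟩ := exists_zfset_of_subset (D := field f) (fun y => ∃ x, x ∈ a ∧ pair x y ∈ f)
    (fun y ⟨x, _, h⟩ => mem_field_right h)
  refine ⟨B, hB, ?_⟩
  obtain ⟨g, hg⟩ := exists_ordinal_bijection B
  refine ⟨_, g, isOrdinal_toZFSet _, ?_, hg⟩
  obtain ⟨o, rfl⟩ := isOrdinal_iff_mem_range_toZFSet.1 ha
  have hcard : B.card ≤ o.card := by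
    rw [← Ordinal.card_toZFSet]
    choose r hr using fun y : B => (hB y).1 y.2
    have : Cardinal.mk B ≤ Cardinal.mk (o.toZFSet) :=
      Cardinal.mk_le_of_injective (f := fun y : B => (⟨r y, (hr y).1⟩ : o.toZFSet)) (by
        intro y z hyz
        have h : r y = r z := congrArg Subtype.val hyz
        exact Subtype.ext (hf _ _ _ (hr y).2 (h ▸ (hr z).2)))
    rw [cardinalMk_coe_sort, cardinalMk_coe_sort] at this
    exact Cardinal.lift_le.1 this
  rcases ((Cardinal.ord_le_ord.2 hcard).trans (Cardinal.ord_card_le o)).eq_or_lt with h | h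
  · exact Or.inl (by rw [h])
  · exact Or.inr (Ordinal.toZFSet_mem_toZFSet_iff.2 h)

/-- `q` is the relation composed of `p` and `b`. -/
def IsComp (p b q : ZFSet.{u}) : Prop :=
  ∀ v, v ∈ q ↔ ∃ x y z, v = pair x z ∧ pair x y ∈ p ∧ pair y z ∈ b

theorem IsComp.unique {p b q r : ZFSet.{u}} (hq : IsComp p b q) (hr : IsComp p b r) : q = r := by
  ext v; rw [hq v, hr v]

theorem IsComp.pair_mem_iff {f g h : ZFSet.{u}} (hh : IsComp f g h) (a d : ZFSet.{u}) :
    pair a d ∈ h ↔ ∃ b, pair a b ∈ f ∧ pair b d ∈ g := by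
  rw [hh]
  constructor
  · rintro ⟨x, y, z, he, h1, h2⟩
    obtain ⟨rfl, rfl⟩ := pair_inj.1 he
    exact ⟨y, h1, h2⟩
  · rintro ⟨b, h1, h2⟩
    exact ⟨a, b, d, rfl, h1, h2⟩

/-- Post-composes with `b` every value of an enumeration `g` of functions: this decodes functions
into `η` as functions into the cover. The composite is determined by `p`, so replacement bounds the
second coordinates. -/
theorem exists_lift (g b : ZFSet.{u}) : ∃ R : ZFSet.{u}, ∀ u, u ∈ R ↔
    ∃ z p q, u = pair z q ∧ pair z p ∈ g ∧ IsComp p b q := by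
  choose C hC using fun p => exists_comp p b
  let := @Classical.allZFSetDefinable
  refine exists_zfset_of_subset (D := prod (field g) (image C (field g))) _ ?_
  rintro _ ⟨z, p, q, rfl, h1, h2⟩
  refine pair_mem_prod.2 ⟨mem_field_left h1, mem_image.2 ⟨p, mem_field_right h1, ?_⟩⟩
  exact IsComp.unique (hC p) h2

theorem IsBijection.singleValued {x y f : ZFSet.{u}} (h : IsBijection x y f) : SingleValued f := by
  intro a b d hb hd
  exact (h.1.2 a (pair_mem_prod.1 (h.1.1 hb)).1).unique hb hd

theorem IsBijection.injective {x y f a b d : ZFSet.{u}} (h : IsBijection x y f)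
    (ha : pair a d ∈ f) (hb : pair b d ∈ f) : a = b :=
  (h.2 d (pair_mem_prod.1 (h.1.1 ha)).2).unique ha hb

theorem IsBijection.comp {x y z f g h : ZFSet.{u}} (hf : IsBijection x y f)
    (hg : IsBijection y z g) (hh : IsComp f g h) : IsBijection x z h := by
  have key := hh.pair_mem_iff
  refine ⟨⟨fun u hu => ?_, fun a ha => ?_⟩, fun d hd => ?_⟩
  · obtain ⟨a, b, d, rfl, h1, h2⟩ := (hh u).1 hu
    exact pair_mem_prod.2 ⟨(pair_mem_prod.1 (hf.1.1 h1)).1, (pair_mem_prod.1 (hg.1.1 h2)).2⟩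
  · obtain ⟨b, hb, -⟩ := hf.1.2 a ha
    obtain ⟨d, hd, -⟩ := hg.1.2 b (pair_mem_prod.1 (hf.1.1 hb)).2
    refine ⟨d, (key _ _).2 ⟨b, hb, hd⟩, fun d' hd' => ?_⟩
    obtain ⟨b', hb', hd'⟩ := (key _ _).1 hd'
    obtain rfl := hf.singleValued _ _ _ hb hb'
    exact hg.singleValued _ _ _ hd' hd
  · obtain ⟨b, hb, -⟩ := hg.2 d hd
    obtain ⟨a, ha, -⟩ := hf.2 b (pair_mem_prod.1 (hg.1.1 hb)).1
    refine ⟨a, (key _ _).2 ⟨b, ha, hb⟩, fun a' ha' => ?_⟩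
    obtain ⟨b', hb', hd'⟩ := (key _ _).1 ha'
    obtain rfl := hg.injective hb hd'
    exact hf.injective hb' ha

end SetEmb
-- Closure properties of `M`, by elementarity.
namespace SetEmb
open ZFSet

section Inner
variable {M : Set ZFSet.{u}}

theorem IsTransitiveClass.pair_left (hM : IsTransitiveClass M) {f x y : ZFSet.{u}} (hf : f ∈ M)
    (h : pair x y ∈ f) : x ∈ M := by
  obtain ⟨⟨z, hz⟩, -⟩ := (transRange_val hM).of_pair_mem (f := ⟨f, hf⟩) h
  exact hz ▸ z.2

theorem IsTransitiveClass.pair_right (hM : IsTransitiveClass M) {f x y : ZFSet.{u}} (hf : f ∈ M)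
    (h : pair x y ∈ f) : y ∈ M := by
  obtain ⟨-, ⟨z, hz⟩⟩ := (transRange_val hM).of_pair_mem (f := ⟨f, hf⟩) h
  exact hz ▸ z.2

theorem toZFSet_mem_of_le (hM : IsTransitiveClass M) {α β : Ordinal.{u}} (h : α ≤ β)
    (hβ : β.toZFSet ∈ M) : α.toZFSet ∈ M := by
  rcases h.eq_or_lt with rfl | h
  · exact hβ
  · exact hM _ hβ _ (Ordinal.toZFSet_mem_toZFSet_iff.2 h)

open Fml

theorem image_pair (hM : IsTransitiveClass M) (j : setLang.ElementaryEmbedding ZFSet.{u} M)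
    (x y : ZFSet.{u}) : (j (pair x y) : ZFSet.{u}) = pair (j x : ZFSet.{u}) (j y : ZFSet.{u}) := by
  have h := (sat_transfer j (pairF 0 1 2)
    (fun n => if n = 0 then pair x y else if n = 1 then x else y)).1
    ((sat_pairF transRange_id _ _ _ _).2 (by simp))
  simpa using (sat_pairF (transRange_val hM) _ _ _ _).1 h

theorem image_mem (j : setLang.ElementaryEmbedding ZFSet.{u} M)
    {x y : ZFSet.{u}} (hxy : x ∈ y) : (j x : ZFSet.{u}) ∈ (j y : ZFSet.{u}) := by
  have h := (sat_transfer j (mem 0 1) (fun n => if n = 0 then x else y)).1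
    (by simpa using hxy)
  simpa using h

theorem image_injective (j : setLang.ElementaryEmbedding ZFSet.{u} M) :
    Function.Injective fun x => (j x : ZFSet.{u}) :=
  fun _ _ h => j.injective (Subtype.ext h)

theorem image_singleValued (hM : IsTransitiveClass M)
    (j : setLang.ElementaryEmbedding ZFSet.{u} M) {f : ZFSet.{u}} (hf : SingleValued f) :
    SingleValued (j f : ZFSet.{u}) :=
  (sat_singleF (transRange_val hM) _ (k := 1) (f := 0) one_pos).1 <|
    (sat_transfer j (singleF 1 0) fun _ => f).1 <|
      (sat_singleF transRange_id _ (k := 1) (f := 0) one_pos).2 hf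

theorem image_isFunc (hM : IsTransitiveClass M)
    (j : setLang.ElementaryEmbedding ZFSet.{u} M) {x y f : ZFSet.{u}} (hf : IsFunc x y f) :
    IsFunc (j x : ZFSet.{u}) (j y : ZFSet.{u}) (j f : ZFSet.{u}) := by
  have h := (sat_transfer j (funcF 3 0 1 2)
    (fun n => if n = 0 then x else if n = 1 then y else f)).1
    ((sat_funcF transRange_id _ (by norm_num) (by norm_num) (by norm_num)).2 (by simpa using hf))
  simpa using (sat_funcF (transRange_val hM) _ (by norm_num) (by norm_num) (by norm_num)).1 h

theorem pair_mem_inner (hM : IsTransitiveClass M) (j : setLang.ElementaryEmbedding ZFSet.{u} M)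
    {x y : ZFSet.{u}} (hx : x ∈ M) (hy : y ∈ M) : pair x y ∈ M := by
  -- A sentence is transferred, so the valuation `fun _ => ∅` is arbitrary.
  have h := (sat_transfer j (all 0 (all 1 (ex 2 (pairF 2 0 1)))) fun _ => ∅).1 (by
    simp [sat_pairF transRange_id])
  simp only [sat_all, sat_ex, sat_pairF (transRange_val hM)] at h
  obtain ⟨z, hz⟩ := h ⟨x, hx⟩ ⟨y, hy⟩
  simp at hz
  exact hz ▸ z.2

theorem exists_ordinal_equinum (hM : IsTransitiveClass M)
    (j : setLang.ElementaryEmbedding ZFSet.{u} M) {A : ZFSet.{u}} (hA : A ∈ M) :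
    ∃ α : Ordinal.{u}, α.toZFSet ∈ M ∧ EquinumIn M α.toZFSet A := by
  have h := (sat_transfer j (all 0 (ex 1 (ex 2 ((ordF 3 1).and (bijF 3 1 0 2))))) fun _ => ∅).1 (by
    simp only [sat_all, sat_ex, sat_and, sat_ordF transRange_id, sat_bijF transRange_id,
      Nat.reduceLT, Function.update_apply, reduceIte, reduceCtorEq,
      OfNat.ofNat_ne_zero, OfNat.ofNat_ne_one, one_ne_zero, zero_ne_one, OfNat.one_ne_ofNat]
    intro x
    obtain ⟨f, hf⟩ := exists_ordinal_bijection x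
    exact ⟨_, f, isOrdinal_toZFSet _, hf⟩)
  simp only [sat_all, sat_ex, sat_and, sat_ordF (transRange_val hM), sat_bijF (transRange_val hM),
      Nat.reduceLT, Function.update_apply, reduceIte, reduceCtorEq,
      OfNat.ofNat_ne_zero, OfNat.ofNat_ne_one, one_ne_zero, zero_ne_one, OfNat.one_ne_ofNat] at h
  obtain ⟨⟨a, ha⟩, f, ho, hf⟩ := h ⟨A, hA⟩
  obtain ⟨α, rfl⟩ := isOrdinal_iff_mem_range_toZFSet.1 ho
  exact ⟨α, ha, f, f.2, hf⟩

theorem exists_image_inner (hM : IsTransitiveClass M)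
    (j : setLang.ElementaryEmbedding ZFSet.{u} M) {f : ZFSet.{u}} (hf : f ∈ M)
    (hs : SingleValued f) {θ : Ordinal.{u}} (hθ : θ.toZFSet ∈ M) :
    ∃ B ∈ M, (∀ x y, x ∈ θ.toZFSet → pair x y ∈ f → y ∈ B) ∧
      ∃ β ≤ θ, EquinumIn M β.toZFSet B := by
  have h := (sat_transfer j (all 0 (all 1 ((ordF 6 1).imp ((singleF 6 0).imp
      (ex 2 ((all 3 ((mem 3 2).iff (ex 4 ((mem 4 1).and (pmemF 4 3 0))))).and
        (ex 4 (ex 5 ((ordF 6 4).and (((eq 4 1).or (mem 4 1)).and (bijF 6 4 2 5)))))))))))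
      fun _ => ∅).1 (by
    simp only [sat_all, sat_ex, sat_and, sat_or, sat_imp, sat_iff, sat_mem, sat_eq,
      sat_ordF transRange_id,
      sat_bijF transRange_id, sat_singleF transRange_id, sat_pmemF transRange_id,
      Nat.reduceLT, Function.update_apply, Nat.reduceEqDiff, reduceIte, reduceCtorEq,
      OfNat.ofNat_ne_zero, OfNat.ofNat_ne_one, one_ne_zero, zero_ne_one, OfNat.one_ne_ofNat]
    intro f a ha hf
    exact exists_image ha hf)
  simp only [sat_all, sat_ex, sat_and, sat_or, sat_imp, sat_iff, sat_mem, sat_eq,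
      sat_ordF (transRange_val hM),
      sat_bijF (transRange_val hM), sat_singleF (transRange_val hM), sat_pmemF (transRange_val hM),
      Nat.reduceLT, Function.update_apply, Nat.reduceEqDiff, reduceIte, reduceCtorEq,
      OfNat.ofNat_ne_zero, OfNat.ofNat_ne_one, one_ne_zero, zero_ne_one, OfNat.one_ne_ofNat] at h
  obtain ⟨B, hB, b, g, hb, hle, hg⟩ := h ⟨f, hf⟩ ⟨_, hθ⟩ (isOrdinal_toZFSet _) hs
  refine ⟨B, B.2, fun x y hx hxy => ?_, ?_⟩
  · exact (hB ⟨y, hM.pair_right hf hxy⟩).2 ⟨⟨x, hM.pair_left hf hxy⟩, hx, hxy⟩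
  · obtain ⟨β, hβ⟩ := isOrdinal_iff_mem_range_toZFSet.1 hb
    rw [← hβ] at hle hg
    refine ⟨β, ?_, g, g.2, hg⟩
    rcases hle with hle | hle
    · exact (Ordinal.toZFSet_injective hle).le
    · exact (Ordinal.toZFSet_mem_toZFSet_iff.1 hle).le

theorem exists_comp_inner (hM : IsTransitiveClass M)
    (j : setLang.ElementaryEmbedding ZFSet.{u} M) {f g : ZFSet.{u}} (hf : f ∈ M) (hg : g ∈ M) :
    ∃ h ∈ M, IsComp f g h := by
  have h := (sat_transfer j (all 0 (all 1 (ex 2 (all 3 ((mem 3 2).iff (ex 4 (ex 5 (ex 6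
      ((pairF 3 4 6).and ((pmemF 4 5 0).and (pmemF 5 6 1)))))))))))
      fun _ => ∅).1 (by
    simp only [sat_all, sat_ex, sat_and, sat_iff, sat_mem,
      sat_pairF transRange_id, sat_pmemF transRange_id,
      Function.update_apply, Nat.reduceEqDiff, reduceIte, reduceCtorEq,
      OfNat.ofNat_ne_zero, OfNat.ofNat_ne_one, one_ne_zero, zero_ne_one, OfNat.one_ne_ofNat]
    exact exists_comp)
  simp only [sat_all, sat_ex, sat_and, sat_iff, sat_mem,
      sat_pairF (transRange_val hM), sat_pmemF (transRange_val hM),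
      Function.update_apply, Nat.reduceEqDiff, reduceIte, reduceCtorEq,
      OfNat.ofNat_ne_zero, OfNat.ofNat_ne_one, one_ne_zero, zero_ne_one, OfNat.one_ne_ofNat] at h
  obtain ⟨r, hr⟩ := h ⟨f, hf⟩ ⟨g, hg⟩
  refine ⟨r, r.2, fun u => ⟨fun hu => ?_, ?_⟩⟩
  · obtain ⟨x, y, z, h⟩ := (hr ⟨u, hM _ r.2 _ hu⟩).1 hu
    exact ⟨x, y, z, h⟩
  · rintro ⟨x, y, z, rfl, h1, h2⟩
    have hx := hM.pair_left hf h1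
    have hz := hM.pair_right hg h2
    exact (hr ⟨_, pair_mem_inner hM j hx hz⟩).2
      ⟨⟨x, hx⟩, ⟨y, hM.pair_right hf h1⟩, ⟨z, hz⟩, rfl, h1, h2⟩

theorem exists_compInv_inner (hM : IsTransitiveClass M)
    (j : setLang.ElementaryEmbedding ZFSet.{u} M) {f g : ZFSet.{u}} (hf : f ∈ M) (hg : g ∈ M) :
    ∃ h ∈ M, ∀ u, u ∈ h ↔ ∃ x y z, u = pair x z ∧ pair x y ∈ f ∧ pair z y ∈ g := by
  have h := (sat_transfer j (all 0 (all 1 (ex 2 (all 3 ((mem 3 2).iff (ex 4 (ex 5 (ex 6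
      ((pairF 3 4 6).and ((pmemF 4 5 0).and (pmemF 6 5 1)))))))))))
      fun _ => ∅).1 (by
    simp only [sat_all, sat_ex, sat_and, sat_iff, sat_mem,
      sat_pairF transRange_id, sat_pmemF transRange_id,
      Function.update_apply, Nat.reduceEqDiff, reduceIte, reduceCtorEq,
      OfNat.ofNat_ne_zero, OfNat.ofNat_ne_one, one_ne_zero, zero_ne_one, OfNat.one_ne_ofNat]
    exact exists_compInv)
  simp only [sat_all, sat_ex, sat_and, sat_iff, sat_mem,
      sat_pairF (transRange_val hM), sat_pmemF (transRange_val hM),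
      Function.update_apply, Nat.reduceEqDiff, reduceIte, reduceCtorEq,
      OfNat.ofNat_ne_zero, OfNat.ofNat_ne_one, one_ne_zero, zero_ne_one, OfNat.one_ne_ofNat] at h
  obtain ⟨r, hr⟩ := h ⟨f, hf⟩ ⟨g, hg⟩
  refine ⟨r, r.2, fun u => ⟨fun hu => ?_, ?_⟩⟩
  · obtain ⟨x, y, z, h⟩ := (hr ⟨u, hM _ r.2 _ hu⟩).1 hu
    exact ⟨x, y, z, h⟩
  · rintro ⟨x, y, z, rfl, h1, h2⟩
    have hx := hM.pair_left hf h1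
    have hz := hM.pair_left hg h2
    exact (hr ⟨_, pair_mem_inner hM j hx hz⟩).2
      ⟨⟨x, hx⟩, ⟨y, hM.pair_right hf h1⟩, ⟨z, hz⟩, rfl, h1, h2⟩

theorem funs_inner_mem (hM : IsTransitiveClass M)
    (j : setLang.ElementaryEmbedding ZFSet.{u} M) {x y : ZFSet.{u}} (hx : x ∈ M) (hy : y ∈ M) :
    ZFSet.sep (fun f => f ∈ M) (funs x y) ∈ M := by
  have h := (sat_transfer j (all 0 (all 1 (ex 2 (all 3 ((mem 3 2).iff (funcF 4 0 1 3))))))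
      fun _ => ∅).1 (by
    simp only [sat_all, sat_ex, sat_iff, sat_mem, sat_funcF transRange_id, Nat.reduceLT,
      Function.update_apply, Nat.reduceEqDiff, reduceIte, reduceCtorEq,
      OfNat.ofNat_ne_zero, OfNat.ofNat_ne_one, one_ne_zero, zero_ne_one, OfNat.one_ne_ofNat]
    exact fun x y => ⟨funs x y, fun f => mem_funs⟩)
  simp only [sat_all, sat_ex, sat_iff, sat_mem, sat_funcF (transRange_val hM), Nat.reduceLT,
      Function.update_apply, Nat.reduceEqDiff, reduceIte, reduceCtorEq,
      OfNat.ofNat_ne_zero, OfNat.ofNat_ne_one, one_ne_zero, zero_ne_one, OfNat.one_ne_ofNat] at h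
  obtain ⟨P, hP⟩ := h ⟨x, hx⟩ ⟨y, hy⟩
  convert P.2
  ext f
  rw [mem_sep, mem_funs]
  exact ⟨fun h => (hP ⟨f, h.2⟩).2 h.1, fun h => ⟨(hP ⟨f, hM _ P.2 _ h⟩).1 h, hM _ P.2 _ h⟩⟩

theorem exists_lift_inner (hM : IsTransitiveClass M)
    (j : setLang.ElementaryEmbedding ZFSet.{u} M) {g b : ZFSet.{u}} (hg : g ∈ M) (hb : b ∈ M) :
    ∃ R ∈ M, ∀ z q, pair z q ∈ R ↔ ∃ p, pair z p ∈ g ∧ IsComp p b q := by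
  have h := (sat_transfer j (all 0 (all 1 (ex 2 (all 3 ((mem 3 2).iff (ex 4 (ex 5 (ex 6
      ((pairF 3 4 6).and ((pmemF 4 5 0).and (all 7 ((mem 7 6).iff (ex 8 (ex 9 (ex 10
      ((pairF 7 8 10).and ((pmemF 8 9 5).and (pmemF 9 10 1))))))))))))))))))
      fun _ => ∅).1 (by
    simp only [sat_all, sat_ex, sat_and, sat_iff, sat_mem,
      sat_pairF transRange_id, sat_pmemF transRange_id,
      Function.update_apply, Nat.reduceEqDiff, reduceIte, reduceCtorEq,
      OfNat.ofNat_ne_zero, OfNat.ofNat_ne_one, one_ne_zero, zero_ne_one, OfNat.one_ne_ofNat]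
    exact exists_lift)
  simp only [sat_all, sat_ex, sat_and, sat_iff, sat_mem,
      sat_pairF (transRange_val hM), sat_pmemF (transRange_val hM),
      Function.update_apply, Nat.reduceEqDiff, reduceIte, reduceCtorEq,
      OfNat.ofNat_ne_zero, OfNat.ofNat_ne_one, one_ne_zero, zero_ne_one, OfNat.one_ne_ofNat] at h
  obtain ⟨R, hR⟩ := h ⟨g, hg⟩ ⟨b, hb⟩
  -- Being a composite is absolute: all coordinates involved, and the pairs formed from them, lie in
  -- `M`.
  have comp_iff : ∀ p q : M, (∀ v : M, (v : ZFSet.{u}) ∈ (q : ZFSet.{u}) ↔ ∃ x y z : M,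
      (v : ZFSet.{u}) = pair (x : ZFSet.{u}) z ∧ pair (x : ZFSet.{u}) y ∈ (p : ZFSet.{u}) ∧
        pair (y : ZFSet.{u}) z ∈ b) ↔ IsComp p b q := by
    intro p q
    constructor
    · intro h v
      constructor
      · intro hv
        obtain ⟨x, y, z, h⟩ := (h ⟨v, hM _ q.2 _ hv⟩).1 hv
        exact ⟨x, y, z, h⟩
      · rintro ⟨x, y, z, rfl, h1, h2⟩
        have hx := hM.pair_left p.2 h1
        have hz := hM.pair_right hb h2
        exact (h ⟨_, pair_mem_inner hM j hx hz⟩).2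
          ⟨⟨x, hx⟩, ⟨y, hM.pair_right p.2 h1⟩, ⟨z, hz⟩, rfl, h1, h2⟩
    · intro h v
      rw [h]
      constructor
      · rintro ⟨x, y, z, hv, h1, h2⟩
        exact ⟨⟨x, hM.pair_left p.2 h1⟩, ⟨y, hM.pair_right p.2 h1⟩, ⟨z, hM.pair_right hb h2⟩,
          hv, h1, h2⟩
      · rintro ⟨x, y, z, h⟩
        exact ⟨x, y, z, h⟩
  simp only [comp_iff] at hR
  refine ⟨R, R.2, fun z q => ⟨fun h => ?_, ?_⟩⟩
  · obtain ⟨z', p, q', he, h1, h2⟩ := (hR ⟨_, hM _ R.2 _ h⟩).1 h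
    obtain ⟨rfl, rfl⟩ := pair_inj.1 he
    exact ⟨p, h1, h2⟩
  · rintro ⟨p, h1, h2⟩
    have hz := hM.pair_left hg h1
    have hp := hM.pair_right hg h1
    obtain ⟨q', hq', hc⟩ := exists_comp_inner hM j hp hb
    obtain rfl := h2.unique hc
    exact (hR ⟨_, pair_mem_inner hM j hz hq'⟩).2 ⟨⟨z, hz⟩, ⟨p, hp⟩, ⟨q, hq'⟩, rfl, h1, h2⟩

end Inner
end SetEmb
-- Counting initial segments of an indexed family.
universe v

namespace SetEmb
open Cardinal

section Combinatorics

/-- Otherwise take `Z ⊆ Y` of size `τ`. No initial segment can contain `Z`, so `Z` is cofinal and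
`Y` is a union of `τ` segments of size at most `τ`. -/
theorem mk_le_of_initial_lt {Y : Type u} {idx : Y → Ordinal.{v}} (hi : Function.Injective idx)
    {τ : Cardinal.{u}} (hτ : ℵ₀ ≤ τ) (h : ∀ y, #{z // idx z < idx y} < τ) : #Y ≤ τ := by
  by_contra! hlt
  obtain ⟨Z, hZ⟩ := le_mk_iff_exists_set.1 hlt.le
  have hex : ∀ x : Y, ∃ z : Z, idx x ≤ idx z := by
    intro x
    by_contra! hx
    refine (h x).not_ge (hZ ▸ ?_)
    exact mk_le_of_injective (f := fun z : Z => (⟨z, hx z⟩ : {z // idx z < idx x}))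
      fun a b hab => Subtype.ext (Subtype.mk.inj hab)
  have hle : ∀ z : Y, #{x // idx x ≤ idx z} ≤ τ := by
    intro z
    have : ({x | idx x ≤ idx z} : Set Y) = insert z {x | idx x < idx z} := by
      ext x
      simp only [Set.mem_ofPred_eq, Set.mem_insert_iff, le_iff_lt_or_eq, hi.eq_iff]
      exact or_comm
    calc #{x // idx x ≤ idx z} = #(insert z {x | idx x < idx z} : Set Y) := by rw [← this]; rfl
      _ ≤ #{x // idx x < idx z} + 1 := mk_insert_le
      _ ≤ τ + 1 := by gcongr; exact (h z).le
      _ = τ := add_one_eq hτ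
  refine hlt.not_ge ?_
  choose r hr using hex
  calc #Y ≤ #(Σ z : Z, {x // idx x ≤ idx z.1}) :=
        mk_le_of_injective (f := fun x => ⟨r x, x, hr x⟩) fun a b hab => by
          have := congrArg (fun s : (Σ z : Z, {x // idx x ≤ idx z.1}) => s.2.1) hab
          exact this
    _ = Cardinal.sum fun z : Z => #{x // idx x ≤ idx z.1} := mk_sigma _
    _ ≤ Cardinal.sum fun _ : Z => τ := sum_le_sum _ _ fun z => hle z
    _ = τ * τ := by rw [sum_const', hZ]
    _ = τ := mul_eq_self hτ

theorem exists_le_initial {Y : Type u} {idx : Y → Ordinal.{v}} (hi : Function.Injective idx)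
    (hY : ℵ₀ < #Y) {τ : Cardinal.{u}} (hτ : τ < #Y) : ∃ y, τ ≤ #{z // idx z < idx y} := by
  by_contra! h
  exact (max_lt hτ hY).not_ge
    (mk_le_of_initial_lt hi (le_max_right τ ℵ₀) fun y => (h y).trans_le (le_max_left _ _))

/-- Choose `s i` with at least `σ i` indices below it, where the cardinals `σ i` are unbounded in
`#Y`. Below `ζ` there are fewer than `#Y` indices, so some `s i` must lie beyond `ζ`. -/
theorem exists_unbounded_family {Y I : Type u} {idx : Y → Ordinal.{v}}
    (hi : Function.Injective idx) (hY : (#Y).IsSingular) (hI : #I = (#Y).ord.cof)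
    {t : Ordinal.{v}} (hlt : ∀ ζ < t, #{z // idx z < ζ} < #Y) :
    ∃ s : I → Y, ∀ ζ < t, ∃ i, ζ < idx (s i) := by
  have hY0 : ℵ₀ < #Y := lt_of_le_of_ne hY.aleph0_le fun h =>
    not_isSingular_aleph0 (h ▸ hY)
  obtain ⟨S, hS, hSc⟩ := Order.exists_cof_eq (α := (#Y).ord.ToType)
  rw [Ordinal.cof_toType, ← hI] at hSc
  obtain ⟨e⟩ := Cardinal.eq.1 hSc.symm
  have hlt' : ∀ a : (#Y).ord.ToType, #(Set.Iio a) < #Y := fun a => by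
    simpa using Cardinal.mk_Iio_lt a
  choose s hs using fun i : I => exists_le_initial hi hY0 (hlt' (e i))
  refine ⟨s, fun ζ hζ => ?_⟩
  -- A singular cardinal is a limit cardinal; the successor gives the strict inequality needed at
  -- the end.
  have h1 := hY.isSuccLimit.succ_lt (hlt ζ hζ)
  obtain ⟨a, ha⟩ : ∃ a : (#Y).ord.ToType, Order.succ #{z // idx z < ζ} ≤ #(Set.Iio a) := by
    set σ := Order.succ #{z // idx z < ζ}
    refine ⟨Ordinal.ToType.mk ⟨σ.ord, ord_lt_ord.2 h1⟩, ?_⟩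
    refine (mk_ord_toType σ).symm.trans_le (mk_le_of_injective (f := fun x : σ.ord.ToType =>
      ⟨Ordinal.ToType.mk ⟨x.toOrd, Set.mem_Iio.2 ((Set.mem_Iio.1 x.toOrd.2).trans (ord_lt_ord.2 h1))⟩,
        Set.mem_Iio.2 (Ordinal.ToType.mk.lt_iff_lt.2 x.toOrd.2)⟩) fun x y hxy => ?_)
    have h := congrArg Subtype.val (Ordinal.ToType.mk.injective (Subtype.mk.inj hxy))
    exact Ordinal.ToType.mk.symm.injective (Subtype.ext h)
  obtain ⟨b, hb, hab⟩ := hS a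
  refine ⟨e.symm ⟨b, hb⟩, ?_⟩
  by_contra! hle
  have h2 := hs (e.symm ⟨b, hb⟩)
  rw [Equiv.apply_symm_apply] at h2
  have h3 : #{z // idx z < idx (s (e.symm ⟨b, hb⟩))} ≤ #{z // idx z < ζ} :=
    mk_subtype_mono fun z hz => lt_of_lt_of_le hz hle
  have h4 : #(Set.Iio a) ≤ #(Set.Iio b) := mk_subtype_mono fun z hz => lt_of_lt_of_le hz hab
  exact (Order.lt_succ _).not_ge ((ha.trans h4).trans (h2.trans h3))

/-- Otherwise `Y` is a union of fewer than `cf(#Y)` sets whose sizes have supremum below `#Y`. -/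
theorem exists_bound_of_lt_cof {Y I : Type u} {idx : Y → Ordinal.{v}} (hY : ℵ₀ ≤ #Y)
    (hI : #I < (#Y).ord.cof) {F : I → Ordinal.{v}} (hF : ∀ i, #{z // idx z < F i} < #Y) :
    ∃ y, ∀ i, F i ≤ idx y := by
  by_contra! h
  choose r hr using h
  have hsup : ⨆ i, #{z // idx z < F i} < #Y := iSup_lt_of_lt_cof_ord hI hF
  have : #Y ≤ #I * ⨆ i, #{z // idx z < F i} :=
    calc #Y ≤ #(Σ i : I, {z // idx z < F i}) :=
        mk_le_of_injective (f := fun x => ⟨r x, x, hr x⟩) fun a b hab => by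
          have := congrArg (fun s : (Σ i : I, {z // idx z < F i}) => s.2.1) hab
          exact this
      _ = Cardinal.sum fun i : I => #{z // idx z < F i} := mk_sigma _
      _ ≤ _ := sum_le_mk_mul_iSup _
  exact this.not_gt (mul_lt_of_lt hY (hI.trans_le (Ordinal.cof_ord_le _)) hsup)

end Combinatorics
end SetEmb
-- Tightness: monotonicity, cofinality and the power bound.
namespace SetEmb
open ZFSet Cardinal

section Tightness
variable {M : Set ZFSet.{u}}

theorem cardIn_le {x : ZFSet.{u}} {α : Ordinal.{u}} (h : EquinumIn M α.toZFSet x) :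
    cardIn M x ≤ α := csInf_le' h

theorem equinumIn_cardIn (hM : IsTransitiveClass M)
    (j : setLang.ElementaryEmbedding ZFSet.{u} M) {A : ZFSet.{u}} (hA : A ∈ M) :
    (cardIn M A).toZFSet ∈ M ∧ EquinumIn M (cardIn M A).toZFSet A := by
  obtain ⟨α, hα, h⟩ := exists_ordinal_equinum hM j hA
  exact ⟨toZFSet_mem_of_le hM (cardIn_le h) hα,
    csInf_mem (s := {α : Ordinal.{u} | EquinumIn M α.toZFSet A}) ⟨α, h⟩⟩

/-- The set `j(lam)` is itself a cover, so the infimum is attained rather than a default value. -/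
theorem exists_cover (j : setLang.ElementaryEmbedding ZFSet.{u} M) (lam : Cardinal.{u}) :
    ∃ A ∈ M, CoversImage j lam.ord.toZFSet A ∧ cardIn M A = tightness j lam :=
  csInf_mem (s := {θ : Ordinal.{u} | ∃ A ∈ M, CoversImage j lam.ord.toZFSet A ∧ cardIn M A = θ})
    ⟨_, j lam.ord.toZFSet, (j lam.ord.toZFSet).2, fun _ hx => image_mem j hx, rfl⟩

theorem tightness_le_cardIn {j : setLang.ElementaryEmbedding ZFSet.{u} M} {lam : Cardinal.{u}}
    {B : ZFSet.{u}} (hB : B ∈ M) (h : CoversImage j lam.ord.toZFSet B) :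
    tightness j lam ≤ cardIn M B := csInf_le' ⟨B, hB, h, rfl⟩

/-- A single-valued relation in `M` sending elements of `ζ` to all `j (p y)` for at least `lam`
many distinct sets `p y` bounds the tightness at `lam`. -/
theorem tightness_le (hM : IsTransitiveClass M) (j : setLang.ElementaryEmbedding ZFSet.{u} M)
    {lam : Cardinal.{u}} {Y : Type u} (hY : lam ≤ #Y) {p : Y → ZFSet.{u}}
    (hp : Function.Injective p) {b : ZFSet.{u}} (hb : b ∈ M) (hs : SingleValued b)
    {ζ : Ordinal.{u}} (hζ : ζ.toZFSet ∈ M)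
    (h : ∀ y, ∃ z ∈ ζ.toZFSet, pair z (j (p y) : ZFSet.{u}) ∈ b) : tightness j lam ≤ ζ := by
  have hL : lift.{u + 1} lam ≤ lift.{u + 1} #Y := lift_le.2 hY
  have hc : #(lam.ord.toZFSet) = lift.{u + 1} lam := by
    rw [cardinalMk_coe_sort, Ordinal.card_toZFSet, card_ord]
  rw [← hc, ← lift_id'.{u, u + 1} #(lam.ord.toZFSet)] at hL
  obtain ⟨q⟩ := lift_mk_le'.1 hL
  -- Since `e` sends `p (q w)` to `w`, `j e` sends `j (p (q w))` to `j w`; hence `b` followed by `j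
  -- e` maps a subset of `ζ` onto a cover of `j[lam]`.
  let e := graph (fun w : lam.ord.toZFSet => p (q w)) (fun w => (w : ZFSet.{u}))
  have he : SingleValued (j e : ZFSet.{u}) :=
    image_singleValued hM j (singleValued_graph (hp.comp q.injective))
  obtain ⟨f, hf, hcomp⟩ := exists_comp_inner hM j hb (j e).2
  have key : ∀ a d, pair a d ∈ f ↔ ∃ c, pair a c ∈ b ∧ pair c d ∈ (j e : ZFSet.{u}) :=
    hcomp.pair_mem_iff
  have hfs : SingleValued f := by
    intro x y z hy hz
    obtain ⟨c, h1, h2⟩ := (key _ _).1 hy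
    obtain ⟨c', h1', h2'⟩ := (key _ _).1 hz
    obtain rfl := hs _ _ _ h1 h1'
    exact he _ _ _ h2 h2'
  obtain ⟨B, hB, hcov, β, hβ, hβB⟩ := exists_image_inner hM j hf hfs hζ
  refine (tightness_le_cardIn hB fun w hw => ?_).trans ((cardIn_le hβB).trans hβ)
  obtain ⟨z, hz, hzb⟩ := h (q ⟨w, hw⟩)
  refine hcov z _ hz ((key _ _).2 ⟨_, hzb, ?_⟩)
  rw [← image_pair hM]
  exact image_mem j (pair_mem_graph.2 ⟨⟨w, hw⟩, rfl, rfl⟩)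

theorem exists_index (j : setLang.ElementaryEmbedding ZFSet.{u} M) {X A b : ZFSet.{u}}
    (hA : CoversImage j X A) {θ : Ordinal.{u}} (hb : IsBijection θ.toZFSet A b) {Y : Type u}
    {p : Y → ZFSet.{u}} (hp : Function.Injective p) (hpX : ∀ y, p y ∈ X) :
    ∃ idx : Y → Ordinal.{u}, Function.Injective idx ∧
      ∀ y, idx y < θ ∧ pair (idx y).toZFSet (j (p y) : ZFSet.{u}) ∈ b := by
  have : ∀ y, ∃ o : Ordinal.{u}, o < θ ∧ pair o.toZFSet (j (p y) : ZFSet.{u}) ∈ b := by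
    intro y
    obtain ⟨z, hz, -⟩ := hb.2 _ (hA _ (hpX y))
    obtain ⟨o, ho, rfl⟩ := Ordinal.mem_toZFSet_iff.1 (pair_mem_prod.1 (hb.1.1 hz)).1
    exact ⟨o, ho, hz⟩
  choose idx hidx using this
  refine ⟨idx, fun y z hyz => hp (image_injective j ?_), hidx⟩
  exact hb.singleValued _ _ _ (hidx y).2 (hyz ▸ (hidx z).2)

theorem mk_index_lt (hM : IsTransitiveClass M) (j : setLang.ElementaryEmbedding ZFSet.{u} M)
    {lam : Cardinal.{u}} {b : ZFSet.{u}} (hb : b ∈ M) (hs : SingleValued b) {Y : Type u}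
    {p : Y → ZFSet.{u}} (hp : Function.Injective p) {idx : Y → Ordinal.{u}}
    (hidx : ∀ y, pair (idx y).toZFSet (j (p y) : ZFSet.{u}) ∈ b) {ζ : Ordinal.{u}}
    (hζM : ζ.toZFSet ∈ M) (hζ : ζ < tightness j lam) : #{y // idx y < ζ} < lam := by
  by_contra! h
  refine hζ.not_ge (tightness_le hM j h (p := fun y => p y.1)
    (hp.comp Subtype.val_injective) hb hs hζM fun y => ?_)
  exact ⟨_, Ordinal.toZFSet_mem_toZFSet_iff.2 y.2, hidx y⟩

/-- The elements of a set, indexed by a type in the universe of the set. -/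
noncomputable def elems (X : ZFSet.{u}) (y : Shrink.{u} X) : ZFSet.{u} := (equivShrink X).symm y

theorem elems_injective (X : ZFSet.{u}) : Function.Injective (elems X) :=
  Subtype.val_injective.comp (equivShrink X).symm.injective

theorem elems_mem (X : ZFSet.{u}) (y : Shrink.{u} X) : elems X y ∈ X :=
  ((equivShrink X).symm y).2

theorem exists_elems_eq {X x : ZFSet.{u}} (hx : x ∈ X) : ∃ y, elems X y = x :=
  ⟨equivShrink X ⟨x, hx⟩, by simp [elems]⟩

theorem mk_shrink_ord (lam : Cardinal.{u}) : #(Shrink.{u} lam.ord.toZFSet) = lam := by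
  rw [show #(Shrink.{u} lam.ord.toZFSet) = lam.ord.toZFSet.card from rfl, Ordinal.card_toZFSet,
    card_ord]

theorem isCardIn_cardIn (hM : IsTransitiveClass M)
    (j : setLang.ElementaryEmbedding ZFSet.{u} M) {A : ZFSet.{u}} (hA : A ∈ M) :
    IsCardIn M (cardIn M A) := by
  obtain ⟨h1, b, hb, hbij⟩ := equinumIn_cardIn hM j hA
  refine ⟨h1, ?_⟩
  rintro α hα ⟨f, hf, hfb⟩
  obtain ⟨g, hg, hc⟩ := exists_comp_inner hM j hf hb
  exact hα.not_ge (cardIn_le ⟨g, hg, hfb.comp hbij hc⟩)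

theorem image_eq_of_mem_ord {j : setLang.ElementaryEmbedding ZFSet.{u} M} {κ : Ordinal.{u}}
    (hκ : IsCriticalPoint j κ) {α : Ordinal.{u}} (hα : α < κ) {x : ZFSet.{u}}
    (hx : x ∈ α.toZFSet) : (j x : ZFSet.{u}) = x := by
  obtain ⟨β, hβ, rfl⟩ := Ordinal.mem_toZFSet_iff.1 hx
  exact hκ.2 β (hβ.trans hα)

/-- The indices inherit the cofinality of `lam`, because initial segments below `t` contain fewer
than `lam` of them. -/
theorem cofIn_tightness (hM : IsTransitiveClass M) {j : setLang.ElementaryEmbedding ZFSet.{u} M}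
    {κ : Ordinal.{u}} (hκ : IsCriticalPoint j κ) {lam ι : Cardinal.{u}} (hlam : lam.IsSingular)
    (hcof : lam.ord.cof = ι) (hι : ι.ord < κ) : cofIn M (tightness j lam) = ι.ord := by
  obtain ⟨A, hA, hcov, hcard⟩ := exists_cover j lam
  obtain ⟨htM, b, hb, hbij⟩ := equinumIn_cardIn hM j hA
  rw [hcard] at htM hbij
  set t := tightness j lam with ht
  set Y := Shrink.{u} lam.ord.toZFSet
  have hY : #Y = lam := mk_shrink_ord lam
  obtain ⟨idx, hinj, hidx⟩ := exists_index j hcov hbij (elems_injective lam.ord.toZFSet)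
    (elems_mem _)
  have hsmall : ∀ ζ < t, #{y : Y // idx y < ζ} < #Y := fun ζ hζ => hY.symm ▸
    mk_index_lt hM j hb hbij.singleValued (elems_injective _) (fun y => (hidx y).2)
      (toZFSet_mem_of_le hM hζ.le htM) hζ
  obtain ⟨s, hs⟩ := exists_unbounded_family (I := Shrink.{u} ι.ord.toZFSet) hinj
    (hY.symm ▸ hlam) (by rw [mk_shrink_ord, hY, hcof]) hsmall
  have hmem : ι.ord ∈ {α : Ordinal.{u} | ∃ f ∈ M, IsCofinalFunc α.toZFSet t.toZFSet f} := by
    let F : ι.ord.toZFSet → ZFSet.{u} := fun i => elems _ (s (equivShrink _ i))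
    have hG := isFunc_graph F (y := lam.ord.toZFSet) fun i => elems_mem _ _
    set G := graph (fun i : ι.ord.toZFSet => (i : ZFSet.{u})) F
    have hjG := image_isFunc hM j hG
    rw [hκ.2 _ hι] at hjG
    have hval : ∀ i : ι.ord.toZFSet, pair (i : ZFSet.{u}) (j (F i) : ZFSet.{u}) ∈
        (j G : ZFSet.{u}) := fun i => by
      have := image_mem j (pair_mem_graph.2 ⟨i, rfl, rfl⟩ : pair (i : ZFSet.{u}) (F i) ∈ G)
      rwa [image_pair hM, image_eq_of_mem_ord hκ hι i.2] at this
    -- As `j` fixes `ι` pointwise, `j G` sends `i` to `j (F i)`; following it by the inverse of `b`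
    -- yields the index sequence, now inside `M`.
    obtain ⟨k, hk, hkc⟩ := exists_compInv_inner hM j (j G).2 hb
    refine ⟨k, hk, ⟨fun u hu => ?_, fun i hi => ?_⟩, fun d hd => ?_⟩
    · obtain ⟨x, y, z, rfl, h1, h2⟩ := (hkc u).1 hu
      exact pair_mem_prod.2 ⟨(pair_mem_prod.1 (hjG.1 h1)).1, (pair_mem_prod.1 (hbij.1.1 h2)).1⟩
    · refine ⟨(idx (s (equivShrink _ ⟨i, hi⟩))).toZFSet,
        (hkc _).2 ⟨_, _, _, rfl, hval ⟨i, hi⟩, (hidx _).2⟩, fun w hw => ?_⟩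
      obtain ⟨x, y, z, he, h1, h2⟩ := (hkc _).1 hw
      obtain ⟨rfl, rfl⟩ := pair_inj.1 he
      obtain rfl := (hjG.2 _ hi).unique h1 (hval ⟨_, hi⟩)
      exact hbij.injective h2 (hidx _).2
    · obtain ⟨ζ, hζ, rfl⟩ := Ordinal.mem_toZFSet_iff.1 hd
      obtain ⟨i, hi⟩ := hs ζ hζ
      refine ⟨_, (idx (s i)).toZFSet, (hkc _).2 ⟨_, _, _, rfl,
        hval ((equivShrink ι.ord.toZFSet).symm i), ?_⟩, Or.inr (Ordinal.toZFSet_mem_toZFSet_iff.2 hi)⟩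
      simpa [F] using (hidx (s i)).2
  refine le_antisymm (csInf_le' hmem) (le_csInf ⟨_, hmem⟩ ?_)
  rintro α ⟨f, hf, hfc⟩
  by_contra! hα
  have hI : #(Shrink.{u} α.toZFSet) < (#Y).ord.cof := by
    rw [show #(Shrink.{u} α.toZFSet) = α.toZFSet.card from rfl, Ordinal.card_toZFSet, hY, hcof]
    exact lt_ord.1 hα
  have hval : ∀ i : Shrink.{u} α.toZFSet, ∃ o : Ordinal.{u}, o < t ∧
      pair (elems _ i) o.toZFSet ∈ f := fun i => by
    obtain ⟨w, hw, -⟩ := hfc.1.2 _ (elems_mem _ i)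
    obtain ⟨o, ho, rfl⟩ := Ordinal.mem_toZFSet_iff.1 (pair_mem_prod.1 (hfc.1.1 hw)).2
    exact ⟨o, ho, hw⟩
  choose F hFt hF using hval
  -- Cofinality allows equality with a value of `f`, so each value is first replaced by a strictly
  -- larger ordinal below `t`.
  have hlim : ∀ o < t, ∃ o' < t, o < o' := fun o ho => by
    obtain ⟨i, hi⟩ := hs o ho
    exact ⟨_, (hidx _).1, hi⟩
  choose F' hF't hF' using fun i => hlim (F i) (hFt i)
  obtain ⟨y, hy⟩ := exists_bound_of_lt_cof (hY.symm ▸ hlam.aleph0_le) hI fun i =>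
    hsmall (F' i) (hF't i)
  obtain ⟨z, w, hzw, hw⟩ := hfc.2 _ (Ordinal.toZFSet_mem_toZFSet_iff.2 (hidx y).1)
  obtain ⟨i, rfl⟩ := exists_elems_eq (pair_mem_prod.1 (hfc.1.1 hzw)).1
  obtain rfl := (hfc.1.2 _ (elems_mem _ i)).unique hzw (hF i)
  have hlt : idx y < F' i := by
    rcases hw with hw | hw
    · exact (Ordinal.toZFSet_injective hw) ▸ hF' i
    · exact (Ordinal.toZFSet_mem_toZFSet_iff.1 hw).trans (hF' i)
  exact hlt.not_ge (hy i)

/-- If `t_j(μ) ≤ t_j(lam)`, every index of an element of `μ` is below `t_j(lam)`, so all initial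
segments have size below `lam`, forcing `μ ≤ lam`. -/
theorem tightness_lt_of_lt (hM : IsTransitiveClass M)
    (j : setLang.ElementaryEmbedding ZFSet.{u} M) {lam μ : Cardinal.{u}} (hlam : ℵ₀ ≤ lam)
    (hμ : lam < μ) : tightness j lam < tightness j μ := by
  by_contra! hle
  obtain ⟨A, hA, hcov, hcard⟩ := exists_cover j μ
  obtain ⟨htM, b, hb, hbij⟩ := equinumIn_cardIn hM j hA
  rw [hcard] at htM hbij
  obtain ⟨idx, hinj, hidx⟩ := exists_index j hcov hbij (elems_injective μ.ord.toZFSet)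
    (elems_mem _)
  refine hμ.not_ge (mk_shrink_ord μ ▸ mk_le_of_initial_lt hinj hlam fun y => ?_)
  exact mk_index_lt hM j hb hbij.singleValued (elems_injective _) (fun y => (hidx y).2)
    (toZFSet_mem_of_le hM (hidx y).1.le htM) ((hidx y).1.trans_le hle)

theorem tightness_power_le (hM : IsTransitiveClass M)
    {j : setLang.ElementaryEmbedding ZFSet.{u} M} {κ : Ordinal.{u}} (hκ : IsCriticalPoint j κ)
    (lam : Cardinal.{u}) {ι : Cardinal.{u}} (hι : ι.ord < κ) :
    tightness j (lam ^ ι) ≤ powIn M (tightness j lam) ι.ord := by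
  obtain ⟨A, hA, hcov, hcard⟩ := exists_cover j lam
  obtain ⟨htM, b, hb, hbij⟩ := equinumIn_cardIn hM j hA
  rw [hcard] at htM hbij
  have hιM : ι.ord.toZFSet ∈ M := hκ.2 _ hι ▸ (j ι.ord.toZFSet).2
  obtain ⟨hpM, g, hg, hgbij⟩ := equinumIn_cardIn hM j (funs_inner_mem hM j hιM htM)
  -- `R` sends a code `z` below `(η^ι)^M` to the function `g(z)` followed by `b`, from `ι` into `A`.
  obtain ⟨R, hR, hRc⟩ := exists_lift_inner hM j hg hb
  let G : (Shrink.{u} ι.ord.toZFSet → Shrink.{u} lam.ord.toZFSet) → ZFSet.{u} := fun s =>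
    graph (fun i : ι.ord.toZFSet => (i : ZFSet.{u})) (fun i => elems _ (s (equivShrink _ i)))
  have hGinj : Function.Injective G := by
    intro s s' h
    funext i
    have h1 : pair (elems _ i) (elems _ (s i)) ∈ G s :=
      pair_mem_graph.2 ⟨(equivShrink _).symm i, rfl, by simp⟩
    rw [h] at h1
    obtain ⟨i', h2, h3⟩ := pair_mem_graph.1 h1
    rw [← Subtype.ext h2] at h3
    simpa using elems_injective _ h3
  refine tightness_le hM j (Y := Shrink.{u} ι.ord.toZFSet → Shrink.{u} lam.ord.toZFSet)
    (by simp [mk_shrink_ord]) hGinj hR ?_ hpM ?_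
  · intro x y z hy hz
    obtain ⟨p, hp, hpc⟩ := (hRc _ _).1 hy
    obtain ⟨p', hp', hpc'⟩ := (hRc _ _).1 hz
    obtain rfl := hgbij.singleValued _ _ _ hp hp'
    exact hpc.unique hpc'
  · intro s
    have hfun : IsFunc ι.ord.toZFSet lam.ord.toZFSet (G s) := isFunc_graph _ fun i => elems_mem _ _
    have hjG := image_isFunc hM j hfun
    rw [hκ.2 _ hι] at hjG
    have hjA : ∀ i w, pair i w ∈ (j (G s) : ZFSet.{u}) → w ∈ A := by
      intro i w hiw
      have hi := (pair_mem_prod.1 (hjG.1 hiw)).1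
      have h1 := image_mem j (pair_mem_graph.2 ⟨⟨i, hi⟩, rfl, rfl⟩ :
        pair i (elems _ (s (equivShrink _ ⟨i, hi⟩))) ∈ G s)
      rw [image_pair hM, image_eq_of_mem_ord hκ hι hi] at h1
      rw [(hjG.2 _ hi).unique hiw h1]
      exact hcov _ (elems_mem _ _)
    -- `p` is `j (G s)` followed by the inverse of `b`: the function `ι → η` in `M` that codes `j (G
    -- s)`.
    obtain ⟨p, hpM', hp⟩ := exists_compInv_inner hM j (j (G s)).2 hb
    have hpair : ∀ x z, pair x z ∈ p ↔ ∃ y, pair x y ∈ (j (G s) : ZFSet.{u}) ∧ pair z y ∈ b := by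
      intro x z
      rw [hp]
      constructor
      · rintro ⟨x', y, z', he, h⟩
        obtain ⟨rfl, rfl⟩ := pair_inj.1 he
        exact ⟨y, h⟩
      · rintro ⟨y, h⟩
        exact ⟨x, y, z, rfl, h⟩
    have hpf : IsFunc ι.ord.toZFSet (tightness j lam).toZFSet p := by
      refine ⟨fun u hu => ?_, fun i hi => ?_⟩
      · obtain ⟨x, y, z, rfl, h1, h2⟩ := (hp u).1 hu
        exact pair_mem_prod.2 ⟨(pair_mem_prod.1 (hjG.1 h1)).1, (pair_mem_prod.1 (hbij.1.1 h2)).1⟩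
      · obtain ⟨w, hw, -⟩ := hjG.2 i hi
        obtain ⟨z, hz, -⟩ := hbij.2 w (hjA _ _ hw)
        refine ⟨z, (hpair _ _).2 ⟨w, hw, hz⟩, fun z' hz' => ?_⟩
        obtain ⟨w', hw', hz'⟩ := (hpair _ _).1 hz'
        obtain rfl := (hjG.2 i hi).unique hw hw'
        exact hbij.injective hz' hz
    obtain ⟨z, hz, -⟩ := hgbij.2 p (mem_sep.2 ⟨mem_funs.2 hpf, hpM'⟩)
    refine ⟨z, (pair_mem_prod.1 (hgbij.1.1 hz)).1, (hRc _ _).2 ⟨p, hz, fun v => ⟨fun hv => ?_, ?_⟩⟩⟩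
    · obtain ⟨i, hi, w, -, rfl⟩ := mem_prod.1 (hjG.1 hv)
      obtain ⟨z, hz, -⟩ := hbij.2 w (hjA _ _ hv)
      exact ⟨i, z, w, rfl, (hpair _ _).2 ⟨w, hv, hz⟩, hz⟩
    · rintro ⟨x, y, w, rfl, h1, h2⟩
      obtain ⟨w', hw', hy⟩ := (hpair _ _).1 h1
      exact hbij.singleValued _ _ _ hy h2 ▸ hw'

end Tightness
end SetEmb

theorem mainTheorem6 (M : Set ZFSet.{u}) (hM : SetEmb.IsTransitiveClass M)
    (j : SetEmb.setLang.ElementaryEmbedding ZFSet.{u} M)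
    (κ : Ordinal.{u}) (hκ : SetEmb.IsCriticalPoint j κ)
    (lam ι : Cardinal.{u}) (hlam : lam.IsSingular) (hcof : lam.ord.cof = ι) (hι : ι.ord < κ) :
    ∃ η : Ordinal.{u}, SetEmb.IsCardIn M η ∧ SetEmb.cofIn M η = ι.ord ∧
      η < SetEmb.tightness j (lam ^ ι) ∧
      SetEmb.tightness j (lam ^ ι) ≤ SetEmb.powIn M η ι.ord := by
  refine ⟨SetEmb.tightness j lam, ?_, SetEmb.cofIn_tightness hM hκ hlam hcof hι, ?_,
    SetEmb.tightness_power_le hM hκ lam hι⟩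
  · obtain ⟨A, hA, -, hcard⟩ := SetEmb.exists_cover j lam
    exact hcard ▸ SetEmb.isCardIn_cardIn hM j hA
  -- König's theorem: `lam < lam ^ cf(lam)`.
  · exact SetEmb.tightness_lt_of_lt hM j hlam.aleph0_le
      (hcof ▸ Cardinal.lt_power_cof_ord hlam.aleph0_le)
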